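/- All graphs are finite and simple. A $k$-hole in a graph is an induced cycle of length $k\ge 4$, and an odd hole is a hole of odd length. The girth of a graph is the length of a shortest cycle (infinite if there is no cycle). Let $\mathcal{G}_2$ be the class of graphs of girth at least $5$ with no odd hole of length at least $9$, and let $\mathcal{A}_3$ be the class of graphs of girth at least $6$ with no odd hole of length at least $9$. Theorem. (a) Every graph in $\mathcal{G}_2$ is $1456$-colorable. (b) A graph lies in $\mathcal{A}_3$ if and only if it lies in $\mathcal{G}_2$ and has no $5$-hole. (c) If $G\in\mathcal{G}_2$ has no $5$-hole (equivalently, $G\in\mathcal{A}_3$), then $G$ is $4$-colorable; moreover, for every vertex $u$ of $G$ and every integer $i\ge 0$, the subgraph of $G$ induced by the set $\{x\in V(G) : d_G(u,x)=i\}$ of vertices at distance exactly $i$ from $u$ is bipartite. -/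

import Mathlib

namespace SimpleGraph

/-- `G` has a `k`-hole: an induced cycle of length `k`, where `k ≥ 4`. -/
def HasHole {V : Type*} (G : SimpleGraph V) (k : ℕ) : Prop :=
  4 ≤ k ∧ (cycleGraph k).IsIndContained G

/-- `G` has no odd hole of length at least `m`. -/
def NoOddHoleFrom {V : Type*} (G : SimpleGraph V) (m : ℕ) : Prop :=
  ∀ k : ℕ, m ≤ k → Odd k → ¬ G.HasHole k

/-- The class `𝒢_ℓ`: girth at least `2ℓ + 1` and no odd hole of length at least `2ℓ + 5`.
The girth `egirth` of a forest is infinite. -/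
def InClassG {V : Type*} (l : ℕ) (G : SimpleGraph V) : Prop :=
  ((2 * l + 1 : ℕ) : ℕ∞) ≤ G.egirth ∧ G.NoOddHoleFrom (2 * l + 5)

/-- The class `𝒜_ℓ`: girth at least `2ℓ` and no odd hole of length at least `2ℓ + 3`. -/
def InClassA {V : Type*} (l : ℕ) (G : SimpleGraph V) : Prop :=
  ((2 * l : ℕ) : ℕ∞) ≤ G.egirth ∧ G.NoOddHoleFrom (2 * l + 3)

/-- The set of vertices at distance exactly `i` from `u`. Vertices that cannot be reached
from `u` have infinite distance and lie in no layer. -/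
def distLayer {V : Type*} (G : SimpleGraph V) (u : V) (i : ℕ) : Set V :=
  {x | G.edist u x = (i : ℕ∞)}

end SimpleGraph

namespace SimpleGraph

variable {V : Type*} {G : SimpleGraph V}

/-! Everything is done in the distance layers from a root: if each layer needs at most `m` colours,
two palettes alternating with the parity of the distance colour the graph with `2 * m`.

Without pentagons a layer is bipartite. Otherwise it contains an odd hole, which must have length 7.
Its vertices have distinct parents in the previous layer, and an induced path through earlier layers
between two parents closes up along either arc of the hole. The two arcs have different parity, so
one of the two holes is odd, and being shorter than 9 it fixes the length of the path. As a result,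
adjacency of `p j` and `p (j + 3)` alternates along the orbit of `j ↦ j + 3` in `Fin 7`, which has
odd length: a contradiction (`not_seven_hole_in_distLayer`). This gives 4 colours in (c).

With pentagons, vertices of a layer are ranked by their least parent. Three rounds of greedy
colouring, 8 colours each, leave a set whose vertices start rank-decreasing paths of length three.
If that set is not 4-colourable, (c) yields a pentagon in it; such a path hung on the pentagon,
joined to it through earlier layers, gives a long odd hole (`exists_long_odd_hole`). So a layer
needs at most 4 + 3 · 8 = 28 colours and the graph 56, well below 1456. -/

/-! ### Short closed walks excluded by the girth -/

/-- No triangles. -/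
def NoTriangle (G : SimpleGraph V) : Prop :=
  ∀ a b c, G.Adj a b → G.Adj b c → ¬ G.Adj c a

/-- Two distinct vertices have at most one common neighbour. -/
def NoSquare (G : SimpleGraph V) : Prop :=
  ∀ a b c d, G.Adj a b → G.Adj b c → G.Adj c d → G.Adj d a → a = c ∨ b = d

/-- No closed walk of length five. -/
def NoPentagon (G : SimpleGraph V) : Prop :=
  ∀ a b c d e, G.Adj a b → G.Adj b c → G.Adj c d → G.Adj d e → ¬ G.Adj e a

lemma noTriangle_of_egirth (h : 5 ≤ G.egirth) : G.NoTriangle := by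
  intro a b c hab hbc hca
  let w : G.Walk a a := .cons hab (.cons hbc (.cons hca .nil))
  have hw : w.IsCycle := by
    have := hab.ne; have := hbc.ne; have := hca.ne
    simp only [w, Walk.cons_isCycle_iff, Walk.cons_isPath_iff]
    simp_all [Ne.symm, eq_comm]
  have h2 := h.trans (egirth_le_length hw)
  simp only [w, Walk.length_cons, Walk.length_nil] at h2
  exact absurd h2 (by norm_num)

lemma noSquare_of_egirth (h : 5 ≤ G.egirth) : G.NoSquare := by
  intro a b c d hab hbc hcd hda
  by_contra! hne
  obtain ⟨h1, h2⟩ := hne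
  let w : G.Walk a a := .cons hab (.cons hbc (.cons hcd (.cons hda .nil)))
  have hw : w.IsCycle := by
    have := hab.ne; have := hbc.ne; have := hcd.ne; have := hda.ne
    simp only [w, Walk.cons_isCycle_iff, Walk.cons_isPath_iff]
    simp_all [Ne.symm, eq_comm]
  have h2 := h.trans (egirth_le_length hw)
  simp only [w, Walk.length_cons, Walk.length_nil] at h2
  exact absurd h2 (by norm_num)

lemma noPentagon_of_egirth (h : 6 ≤ G.egirth) : G.NoPentagon := by
  intro a b c d e hab hbc hcd hde hea
  have ht := noTriangle_of_egirth (le_trans (by norm_num) h)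
  have h1 : a ≠ c := by rintro rfl; exact ht _ _ _ hcd hde hea
  have h2 : b ≠ d := by rintro rfl; exact ht _ _ _ hab hde hea
  have h3 : c ≠ e := by rintro rfl; exact ht _ _ _ hab hbc hea
  have h4 : d ≠ a := by rintro rfl; exact ht _ _ _ hab hbc hcd
  have h5 : e ≠ b := by rintro rfl; exact ht _ _ _ hbc hcd hde
  let w : G.Walk a a := .cons hab (.cons hbc (.cons hcd (.cons hde (.cons hea .nil))))
  have hw : w.IsCycle := by
    have := hab.ne; have := hbc.ne; have := hcd.ne; have := hde.ne; have := hea.ne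
    simp only [w, Walk.cons_isCycle_iff, Walk.cons_isPath_iff]
    simp_all [Ne.symm, eq_comm]
  have h2 := h.trans (egirth_le_length hw)
  simp only [w, Walk.length_cons, Walk.length_nil] at h2
  exact absurd h2 (by norm_num)

lemma NoSquare.eq (h : G.NoSquare) {a b c d : V} (hac : a ≠ c) (h1 : G.Adj a b) (h2 : G.Adj c b)
    (h3 : G.Adj a d) (h4 : G.Adj c d) : b = d :=
  (h a b c d h1 h2.symm h4 h3.symm).resolve_left hac

/-! ### Recognising and finding holes -/

/-- The first `k` values of `h` form, in this order, an induced cycle. -/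
lemma hasHole_of_forall_adj_iff {k : ℕ} (hk : 5 ≤ k) (h : ℕ → V)
    (hh : ∀ i j, i < j → j < k → (G.Adj (h i) (h j) ↔ j = i + 1 ∨ (i = 0 ∧ j + 1 = k))) :
    G.HasHole k := by
  -- Injectivity follows from the adjacency pattern: for `k ≥ 5` distinct vertices of a `k`-cycle
  -- have different neighbourhoods. This fails for `k = 4`.
  have hinj : ∀ i j, i < j → j < k → h i ≠ h j := by
    intro i j hij hj he
    by_cases h0 : j + 1 < k
    · have h1 := (hh j (j + 1) (by omega) h0).2 (Or.inl rfl)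
      rw [← he, hh i (j + 1) (by omega) h0] at h1
      have h2 : i = 0 ∧ j + 2 = k := by omega
      obtain ⟨rfl, h2⟩ := h2
      have h1 := (hh (j - 1) j (by omega) hj).2 (Or.inl (by omega))
      rw [← he, adj_comm, hh 0 (j - 1) (by omega) (by omega)] at h1
      omega
    · by_cases hi : i = 0
      · subst hi
        have h1 := (hh (j - 1) j (by omega) hj).2 (Or.inl (by omega))
        rw [← he, adj_comm, hh 0 (j - 1) (by omega) (by omega)] at h1
        omega
      · have h1 := (hh (i - 1) i (by omega) (by omega)).2 (Or.inl (by omega))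
        rw [he, hh (i - 1) j (by omega) hj] at h1
        have h3 : i = 1 := by omega
        subst h3
        have h1 := (hh 1 2 (by omega) (by omega)).2 (Or.inl rfl)
        rw [he, adj_comm, hh 2 j (by omega) (by omega)] at h1
        omega
  have hinj' : Function.Injective (fun i : Fin k => h i) := by
    intro i j hij
    rcases lt_trichotomy i.1 j.1 with hlt | heq | hlt
    · exact absurd hij (hinj _ _ hlt j.2)
    · exact Fin.ext heq
    · exact absurd hij.symm (hinj _ _ hlt i.2)
  refine ⟨by omega, ⟨⟨⟨fun i => h i, hinj'⟩, ?_⟩⟩⟩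
  have key : ∀ i j : Fin k, i.1 < j.1 → (G.Adj (h i) (h j) ↔ (cycleGraph k).Adj i j) := by
    intro i j hij
    rw [hh _ _ hij j.2, cycleGraph_adj', Fin.sub_def, Fin.sub_def]
    have hi := i.2; have hj := j.2
    have e1 : (k - i.1 + j.1) % k = j.1 - i.1 := by
      rw [show k - i.1 + j.1 = (j.1 - i.1) + k by omega, Nat.add_mod_right,
        Nat.mod_eq_of_lt (by omega)]
    have e2 : (k - j.1 + i.1) % k = k - j.1 + i.1 := Nat.mod_eq_of_lt (by omega)
    simp only [e1, e2]
    omega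
  intro i j
  change G.Adj (h i) (h j) ↔ _
  rcases lt_trichotomy i.1 j.1 with hlt | heq | hlt
  · exact key _ _ hlt
  · rw [Fin.ext heq]; simp
  · rw [adj_comm, key _ _ hlt, adj_comm]

/-- Among `f 0, …, f n`, exactly the consecutive vertices are adjacent. -/
def IsIndPath (G : SimpleGraph V) (f : ℕ → V) (n : ℕ) : Prop :=
  ∀ i j, i < j → j ≤ n → (G.Adj (f i) (f j) ↔ j = i + 1)

/-- Two induced paths whose ends are joined crosswise form a hole. -/
lemma hasHole_of_isIndPath {f g : ℕ → V} {n m : ℕ} (hnm : 3 ≤ n + m) (hf : G.IsIndPath f n)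
    (hg : G.IsIndPath g m)
    (h : ∀ i j, i ≤ n → j ≤ m → (G.Adj (f i) (g j) ↔ (i = n ∧ j = 0) ∨ (i = 0 ∧ j = m))) :
    G.HasHole (n + m + 2) := by
  refine hasHole_of_forall_adj_iff (by omega) (fun t => if t ≤ n then f t else g (t - (n + 1))) ?_
  intro i j hij hj
  by_cases h1 : i ≤ n <;> by_cases h2 : j ≤ n
  · simp only [h1, h2, if_true]; rw [hf _ _ hij h2]; omega
  · simp only [h1, h2, if_true, if_false]; rw [h _ _ h1 (by omega)]; omega
  · omega
  · simp only [h1, h2, if_false]; rw [hg _ _ (by omega) (by omega)]; omega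

/-- A shortest path inside a vertex set is induced. -/
lemma exists_isIndPath {W : Set V} {a b : V} (ha : a ∈ W) (hb : b ∈ W)
    (hr : (G.induce W).Reachable ⟨a, ha⟩ ⟨b, hb⟩) :
    ∃ (f : ℕ → V) (n : ℕ), f 0 = a ∧ f n = b ∧ (∀ i, f i ∈ W) ∧ G.IsIndPath f n ∧
      ∀ i j, i < j → j ≤ n → f i ≠ f j := by
  obtain ⟨w, hw⟩ := hr.exists_walk_length_eq_dist
  have hmin : ∀ w' : (G.induce W).Walk ⟨a, ha⟩ ⟨b, hb⟩, w.length ≤ w'.length := by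
    intro w'; rw [hw]; exact dist_le w'
  refine ⟨fun i => (w.getVert i).1, w.length, by simp, by simp, fun i => (w.getVert i).2, ?_, ?_⟩
  · intro i j hij hj
    constructor
    · intro hadj
      have hadj' : (G.induce W).Adj (w.getVert i) (w.getVert j) := hadj
      have := hmin ((w.take i).append (.cons hadj' (w.drop j)))
      simp only [Walk.length_append, Walk.take_length, Walk.length_cons, Walk.drop_length] at this
      omega
    · rintro rfl
      exact w.adj_getVert_succ (i := i) (by omega)
  · intro i j hij hj he
    have he' : w.getVert i = w.getVert j := Subtype.ext he
    have := hmin ((w.take i).append ((w.drop j).copy he'.symm rfl))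
    simp only [Walk.length_append, Walk.take_length, Walk.length_copy, Walk.drop_length] at this
    omega

/-- A shortest odd closed walk in a triangle-free graph is a hole. -/
lemma exists_odd_hole (ht : G.NoTriangle) (h : ¬ G.Colorable 2) :
    ∃ k, 5 ≤ k ∧ Odd k ∧ G.HasHole k := by
  classical
  rw [two_colorable_iff_forall_loop_even] at h
  push Not at h
  have hex : ∃ k, ∃ (u : V) (w : G.Walk u u), w.length = k ∧ Odd k := by
    obtain ⟨u, w, hw⟩ := h
    exact ⟨_, u, w, rfl, by simpa using hw⟩
  obtain ⟨u, w, hw, hodd⟩ := Nat.find_spec hex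
  have hmin : ∀ (v : V) (w' : G.Walk v v), Odd w'.length → Nat.find hex ≤ w'.length :=
    fun v w' h' => Nat.find_min' hex ⟨v, w', rfl, h'⟩
  generalize Nat.find hex = k at *
  have hk0 : w.getVert k = w.getVert 0 := by rw [← hw]; simp
  have hstep : ∀ i, i < k → G.Adj (w.getVert i) (w.getVert (i + 1)) :=
    fun i hi => w.adj_getVert_succ (by omega)
  have hk1 : k ≠ 1 := by
    rintro rfl
    have := hstep 0 (by omega)
    rw [zero_add, hk0] at this
    exact this.ne rfl
  have hk3 : k ≠ 3 := by
    rintro rfl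
    have h1 := hstep 0 (by omega)
    have h2 := hstep 1 (by omega)
    have h3 := hstep 2 (by omega)
    rw [hk0] at h3
    exact ht _ _ _ h1 h2 h3
  have hk5 : 5 ≤ k := by obtain ⟨r, hr⟩ := hodd; omega
  refine ⟨k, hk5, hodd, hasHole_of_forall_adj_iff hk5 w.getVert ?_⟩
  intro i j hij hj
  constructor
  · intro hadj
    by_contra hne
    -- A chord splits the closed walk into closed walks of lengths `j - i + 1` and `k - (j - i) +
    -- 1`. Their sum `k + 2` is odd, so one of them is odd, and it is shorter than `k`.
    have l1 := hmin _ (.cons hadj.symm ((w.drop i).take (j - i) |>.copy rfl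
      (by rw [Walk.drop_getVert]; congr 1; omega)))
    have l2 := hmin _ ((w.take i).append (.cons hadj (w.drop j)))
    simp only [Walk.length_append, Walk.take_length, Walk.length_copy, Walk.drop_length,
      Walk.length_cons] at l1 l2
    rw [Nat.odd_iff] at l1 l2 hodd
    omega
  · rintro (rfl | ⟨rfl, hjk⟩)
    · exact hstep _ (by omega)
    · have := hstep j hj
      rw [hjk, hk0] at this
      exact this.symm

/-! ### Colourings of vertex sets and distance layers -/

lemma colorable_induce_iff {W : Set V} {m : ℕ} :
    (G.induce W).Colorable m ↔ ∃ col : V → ℕ, (∀ x ∈ W, col x < m) ∧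
      ∀ x ∈ W, ∀ y ∈ W, G.Adj x y → col x ≠ col y := by
  classical
  constructor
  · rintro ⟨C⟩
    refine ⟨fun x => if h : x ∈ W then (C ⟨x, h⟩ : ℕ) else 0, ?_, ?_⟩
    · intro x hx
      simp [hx]
    · intro x hx y hy hxy
      have : C ⟨x, hx⟩ ≠ C ⟨y, hy⟩ := C.valid hxy
      simpa [hx, hy, Fin.ext_iff] using this
  · rintro ⟨col, h1, h2⟩
    refine ⟨Coloring.mk (fun x => ⟨col x.1, h1 _ x.2⟩) ?_⟩
    intro x y hxy
    simpa [Fin.ext_iff] using h2 _ x.2 _ y.2 hxy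

lemma colorable_induce_of_sdiff {X Y : Set V} {m d : ℕ} (h : (G.induce Y).Colorable m)
    (h' : (G.induce (X \ Y)).Colorable d) : (G.induce X).Colorable (m + d) := by
  classical
  obtain ⟨c, h1, h2⟩ := colorable_induce_iff.1 h
  obtain ⟨c', h1', h2'⟩ := colorable_induce_iff.1 h'
  refine colorable_induce_iff.2 ⟨fun x => if x ∈ Y then c x else m + c' x, ?_, ?_⟩
  · intro x hx
    by_cases hY : x ∈ Y
    · simp only [hY, if_true]; have := h1 x hY; omega
    · simp only [hY, if_false]; have := h1' x ⟨hx, hY⟩; omega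
  · intro x hx y hy hxy
    by_cases hxY : x ∈ Y <;> by_cases hyY : y ∈ Y <;> simp only [hxY, hyY, if_true, if_false]
    · exact h2 x hxY y hyY hxy
    · have := h1 x hxY; omega
    · have := h1 y hyY; omega
    · have := h2' x ⟨hx, hxY⟩ y ⟨hy, hyY⟩ hxy; omega

lemma mem_distLayer {u x : V} {i : ℕ} : x ∈ G.distLayer u i ↔ G.edist u x = i := Iff.rfl

lemma distLayer_unique {u x : V} {i j : ℕ} (hi : x ∈ G.distLayer u i)
    (hj : x ∈ G.distLayer u j) : i = j := by
  rw [mem_distLayer] at hi hj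
  exact_mod_cast hi.symm.trans hj

lemma distLayer_zero {u x : V} (h : x ∈ G.distLayer u 0) : x = u := by
  rw [mem_distLayer] at h
  exact (edist_eq_zero_iff.1 (h.trans Nat.cast_zero)).symm

lemma distLayer_adj_le {u x y : V} {i j : ℕ} (hx : x ∈ G.distLayer u i)
    (hy : y ∈ G.distLayer u j) (h : G.Adj x y) : j ≤ i + 1 := by
  rw [mem_distLayer] at hx hy
  have := G.edist_triangle (u := u) (v := x) (w := y)
  rw [hx, hy, edist_eq_one_iff_adj.2 h] at this
  exact_mod_cast this

lemma exists_parent {u x : V} {i : ℕ} (hx : x ∈ G.distLayer u (i + 1)) :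
    ∃ y ∈ G.distLayer u i, G.Adj y x := by
  obtain ⟨w, hw⟩ := exists_walk_of_edist_eq_coe hx
  have hadj : G.Adj (w.getVert i) x := by
    have := w.adj_getVert_succ (i := i) (by omega)
    rwa [← hw, Walk.getVert_length] at this
  refine ⟨w.getVert i, ?_, hadj⟩
  rw [mem_distLayer]
  refine le_antisymm ?_ ?_
  · refine (edist_le (w.take i)).trans ?_
    rw [Walk.take_length]
    exact_mod_cast min_le_left _ _
  · have := G.edist_triangle (u := u) (v := w.getVert i) (w := x)
    rw [mem_distLayer.1 hx, edist_eq_one_iff_adj.2 hadj] at this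
    push_cast at this
    exact (ENat.add_le_add_iff_right (by simp)).1 this

lemma reachable_root {u : V} {W : Set V} : ∀ (m : ℕ) (x : V) (hx : x ∈ W),
    x ∈ G.distLayer u m → (∀ k < m, G.distLayer u k ⊆ W) →
    ∃ hu : u ∈ W, (G.induce W).Reachable ⟨x, hx⟩ ⟨u, hu⟩
  | 0, x, hx, hm, _ => by
    obtain rfl := distLayer_zero hm
    exact ⟨hx, Reachable.refl _⟩
  | m + 1, x, hx, hm, hW => by
    obtain ⟨y, hy, hyx⟩ := exists_parent hm
    obtain ⟨hu, hr⟩ := reachable_root m y (hW m (by omega) hy) hy (fun k hk => hW k (by omega))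
    refine ⟨hu, Reachable.trans (Adj.reachable ?_) hr⟩
    exact hyx.symm

/-- Doubling the number of colours needed for the distance layers suffices for the graph. -/
lemma colorable_of_distLayer {m : ℕ}
    (h : ∀ u i, (G.induce (G.distLayer u i)).Colorable m) : G.Colorable (2 * m) := by
  classical
  have h' := fun u i => colorable_induce_iff.1 (h u i)
  choose col h1 h2 using h'
  let r : V → V := fun x => (G.connectedComponentMk x).out
  let d : V → ℕ := fun x => (G.edist (r x) x).toNat
  have hd : ∀ x, x ∈ G.distLayer (r x) (d x) := by
    intro x
    have hr : G.Reachable (r x) x := ConnectedComponent.exact (Quot.out_eq _)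
    exact (ENat.natCast_toNat (edist_ne_top_iff_reachable.2 hr)).symm
  -- Adjacent vertices share a root and their distances from it differ by at most one, so equal
  -- parity forces the same layer.
  have C : G.Coloring (Fin 2 × Fin m) := by
    refine Coloring.mk (fun x => (⟨d x % 2, Nat.mod_lt _ (by norm_num)⟩,
      ⟨col (r x) (d x) x, h1 _ _ _ (hd x)⟩)) ?_
    intro x y hxy he
    have hrr : r x = r y := by
      simp only [r, ConnectedComponent.sound hxy.reachable]
    have hx := hd x
    have hy := hd y
    simp only [Prod.mk.injEq, Fin.mk.injEq] at he
    obtain ⟨he1, he2⟩ := he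
    rw [hrr] at hx he2
    have l1 := distLayer_adj_le hx hy hxy
    have l2 := distLayer_adj_le hy hx hxy.symm
    have hdd : d x = d y := by omega
    rw [hdd] at hx he2
    exact h2 _ _ x hx y hy hxy he2
  simpa using C.colorable

/-! ### Induced paths through earlier layers -/

lemma exists_isIndPath_of_layer {u p q : V} {m : ℕ} {W : Set V} (hp : p ∈ G.distLayer u m)
    (hq : q ∈ G.distLayer u m) (hpW : p ∈ W) (hqW : q ∈ W)
    (hW : ∀ k < m, G.distLayer u k ⊆ W) :
    ∃ (f : ℕ → V) (n : ℕ), f 0 = p ∧ f n = q ∧ (∀ i, f i ∈ W) ∧ G.IsIndPath f n ∧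
      ∀ i j, i < j → j ≤ n → f i ≠ f j := by
  obtain ⟨hu, h1⟩ := reachable_root m p hpW hp hW
  obtain ⟨_, h2⟩ := reachable_root m q hqW hq hW
  exact exists_isIndPath hpW hqW (h1.trans h2.symm)

/-- Two vertices of a layer are joined by an induced path with interior in earlier layers. -/
lemma exists_isIndPath_above {u p q : V} {m : ℕ} (hp : p ∈ G.distLayer u (m + 1))
    (hq : q ∈ G.distLayer u (m + 1)) :
    ∃ (f : ℕ → V) (n : ℕ), f 0 = p ∧ f n = q ∧ G.IsIndPath f n ∧
      ∀ i, 0 < i → i < n → ∃ k ≤ m, f i ∈ G.distLayer u k := by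
  obtain ⟨f, n, h0, hn, hW, hf, hinj⟩ := exists_isIndPath_of_layer
    (W := {x | (∃ k ≤ m, x ∈ G.distLayer u k) ∨ x = p ∨ x = q}) hp hq (by simp) (by simp)
    (fun k hk x hx => Or.inl ⟨k, by omega, hx⟩)
  refine ⟨f, n, h0, hn, hf, fun i hi hin => ?_⟩
  rcases hW i with h | h | h
  · exact h
  · exact absurd (h0.trans h.symm) (hinj 0 i hi hin.le)
  · exact absurd (h.trans hn.symm) (hinj i n hin le_rfl)

/-- The interior can be forced to meet the previous layer in two prescribed vertices only. -/
lemma exists_isIndPath_through {u p q a b : V} {m : ℕ}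
    (ha : a ∈ G.distLayer u m) (hb : b ∈ G.distLayer u m)
    (hap : G.Adj p a) (hbq : G.Adj q b) :
    ∃ (f : ℕ → V) (n : ℕ), f 0 = p ∧ f n = q ∧ G.IsIndPath f n ∧
      ∀ i, 0 < i → i < n → (∃ k < m, f i ∈ G.distLayer u k) ∨ f i = a ∨ f i = b := by
  let W : Set V := {x | ((∃ k < m, x ∈ G.distLayer u k) ∨ x = a ∨ x = b) ∨ x = p ∨ x = q}
  have haW : a ∈ W := by simp [W]
  have hbW : b ∈ W := by simp [W]
  have hpW : p ∈ W := by simp [W]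
  have hqW : q ∈ W := by simp [W]
  have hW : ∀ k < m, G.distLayer u k ⊆ W := fun k hk x hx => Or.inl (Or.inl ⟨k, hk, hx⟩)
  obtain ⟨hu, h1⟩ := reachable_root m a haW ha hW
  obtain ⟨_, h2⟩ := reachable_root m b hbW hb hW
  have h3 : (G.induce W).Adj ⟨p, hpW⟩ ⟨a, haW⟩ := hap
  have h4 : (G.induce W).Adj ⟨q, hqW⟩ ⟨b, hbW⟩ := hbq
  obtain ⟨f, n, h0, hn, hW, hf, hinj⟩ := exists_isIndPath hpW hqW
    (h3.reachable.trans (h1.trans (h2.symm.trans h4.symm.reachable)))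
  refine ⟨f, n, h0, hn, hf, fun i hi hin => ?_⟩
  rcases hW i with h | h | h
  · exact h
  · exact absurd (h0.trans h.symm) (hinj 0 i hi hin.le)
  · exact absurd (h.trans hn.symm) (hinj i n hin le_rfl)

/-! ### Layers without pentagons are bipartite -/

lemma isIndPath_arc {c : Fin 7 → V} (hc : ∀ i j, G.Adj (c i) (c j) ↔ i - j = 1 ∨ j - i = 1)
    (b : Fin 7) {m : ℕ} (hm : m ≤ 5) : G.IsIndPath (fun t => c (b + Fin.ofNat 7 t)) m := by
  intro i j hij hj
  rw [hc]
  have hj' : j ≤ 5 := hj.trans hm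
  clear hj hm hc
  revert b
  interval_cases j <;> interval_cases i <;> decide

/-- An induced path between neighbours of two vertices of a `7`-hole closes up along an arc. -/
lemma hasHole_of_arc {c p : Fin 7 → V}
    (hc : ∀ i j, G.Adj (c i) (c j) ↔ i - j = 1 ∨ j - i = 1)
    (hp : ∀ j k, G.Adj (p j) (c k) ↔ j = k) {a b : Fin 7} {m n : ℕ} (hm : m ≤ 5)
    (hba : b + Fin.ofNat 7 m = a) {f : ℕ → V} (hf : G.IsIndPath f n) (h0 : f 0 = p a)
    (hn : f n = p b) (hn1 : 1 ≤ n) (hnm : 3 ≤ n + m)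
    (hint : ∀ i, 0 < i → i < n → ∀ k, ¬ G.Adj (f i) (c k)) :
    G.HasHole (n + m + 2) := by
  refine hasHole_of_isIndPath hnm hf (isIndPath_arc hc b hm) ?_
  intro i j hi hj
  rcases Nat.eq_zero_or_pos i with rfl | hi0
  · rw [h0, hp, ← hba]
    have hj' : j ≤ 5 := hj.trans hm
    have : (b + Fin.ofNat 7 m = b + Fin.ofNat 7 j) ↔ j = m := by
      rw [add_right_inj]
      clear * - hj' hm
      interval_cases j <;> interval_cases m <;> decide
    rw [this]
    omega
  · rcases hi.lt_or_eq with hin | rfl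
    · simp only [hint i hi0 hin, false_iff]
      omega
    · rw [hn, hp]
      have hj' : j ≤ 5 := hj.trans hm
      have : b = b + Fin.ofNat 7 j ↔ j = 0 := by
        rw [left_eq_add]
        clear * - hj'
        interval_cases j <;> decide
      rw [this]
      omega

/-- A distance layer of a graph of girth at least six without odd holes of length at least nine
contains no `7`-hole. -/
lemma not_seven_hole_in_distLayer (ht : G.NoTriangle) (hs : G.NoSquare) (h5 : G.NoPentagon)
    (hG : G.NoOddHoleFrom 9) {c : Fin 7 → V}
    (hc : ∀ i j, G.Adj (c i) (c j) ↔ i - j = 1 ∨ j - i = 1) (u : V) (i : ℕ)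
    (hL : ∀ j, c j ∈ G.distLayer u i) : False := by
  have hadj : ∀ i j : Fin 7, (i - j = 1 ∨ j - i = 1) → G.Adj (c i) (c j) :=
    fun i j h => (hc i j).2 h
  have hinj : ∀ i j, i ≠ j → c i ≠ c j := by
    intro i j hij he
    obtain ⟨k, h1, h2⟩ : ∃ k, (i - k = 1 ∨ k - i = 1) ∧ ¬ (j - k = 1 ∨ k - j = 1) := by
      clear * - hij; revert i j; decide
    rw [← hc, he, hc] at h1
    exact h2 h1
  -- A parent of `c j` sees no other vertex of the hole: a second neighbour at cyclic distance 1, 2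
  -- or 3 would close a triangle, a square or a pentagon.
  have hparent : ∀ {m}, (∀ j, c j ∈ G.distLayer u (m + 1)) →
      ∃ p : Fin 7 → V, (∀ j, p j ∈ G.distLayer u m) ∧ ∀ j k, G.Adj (p j) (c k) ↔ j = k := by
    intro m hL
    choose p hpL hpc using fun j => exists_parent (hL j)
    refine ⟨p, hpL, fun j k => ⟨fun h => ?_, by rintro rfl; exact hpc j⟩⟩
    obtain ⟨d, rfl⟩ : ∃ d, k = j + d := ⟨k - j, by abel⟩
    have hj := hpc j
    have e : ∀ a b : Fin 7, (a - b = 1 ∨ b - a = 1) → G.Adj (c (j + a)) (c (j + b)) := by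
      intro a b hab
      refine hadj _ _ ?_
      simpa only [add_sub_add_left_eq_sub] using hab
    have hpc' : ∀ a, p j ≠ c a := fun a he => by
      have h1 := hpL j
      rw [he] at h1
      have := distLayer_unique h1 (hL a)
      omega
    have hj0 : j ≠ j + 2 ∧ j ≠ j + 5 := by clear * -; revert j; decide
    have e0 := fun b hb => e 0 b hb
    simp only [add_zero] at e0
    have hd : d = 0 ∨ d = 1 ∨ d = 2 ∨ d = 3 ∨ d = 4 ∨ d = 5 ∨ d = 6 := by
      clear * -; revert d; decide
    rcases hd with rfl | rfl | rfl | rfl | rfl | rfl | rfl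
    · simp
    · exact absurd h.symm (ht _ _ _ hj (e0 1 (by decide)))
    · rcases hs _ _ _ _ hj (e0 1 (by decide)) (e 1 2 (by decide)) h.symm with h' | h'
      · exact absurd h' (hpc' _)
      · exact absurd h' (hinj _ _ hj0.1)
    · exact absurd h.symm (h5 _ _ _ _ _ hj (e0 1 (by decide)) (e 1 2 (by decide))
        (e 2 3 (by decide)))
    · exact absurd h.symm (h5 _ _ _ _ _ hj (e0 6 (by decide)) (e 6 5 (by decide))
        (e 5 4 (by decide)))
    · rcases hs _ _ _ _ hj (e0 6 (by decide)) (e 6 5 (by decide)) h.symm with h' | h'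
      · exact absurd h' (hpc' _)
      · exact absurd h' (hinj _ _ hj0.2)
    · exact absurd h.symm (ht _ _ _ hj (e0 6 (by decide)))
  obtain _ | i := i
  · have := hadj 0 1 (by decide)
    rw [distLayer_zero (hL 0), distLayer_zero (hL 1)] at this
    exact this.ne rfl
  obtain ⟨p, hpL, hp⟩ := hparent hL
  have hpp : ∀ j k, j ≠ k → p j ≠ p k := by
    intro j k hjk he
    have := (hp k k).2 rfl
    rw [← he, hp] at this
    exact hjk this
  obtain _ | m := i
  · exact hpp 0 1 (by decide) ((distLayer_zero (hpL 0)).trans (distLayer_zero (hpL 1)).symm)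
  have hpath : ∀ j k, j ≠ k → ∀ (f : ℕ → V) (n : ℕ), f 0 = p j → f n = p k → 1 ≤ n := by
    intro j k hjk f n h0 hn
    rcases Nat.eq_zero_or_pos n with rfl | h
    · exact absurd (h0.symm.trans hn) (hpp _ _ hjk)
    · exact h
  have hlow : ∀ x k, k ≤ m → x ∈ G.distLayer u k → ∀ j, ¬ G.Adj x (c j) := by
    intro x k hk hx j h
    have := distLayer_adj_le hx (hL j) h
    omega
  have hlow' : ∀ x k, k ≤ m → x ∈ G.distLayer u k → ∀ j, G.Adj x (p j) → x ∈ G.distLayer u m := by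
    intro x k hk hx j h
    have := distLayer_adj_le hx (hpL j) h
    obtain rfl : k = m := by omega
    exact hx
  have hn2 : ∀ j, ¬ G.Adj (p j) (p (j + 2)) := by
    intro j h
    exact h5 _ _ _ _ _ ((hp j j).2 rfl) (hadj j (j + 1) (by clear * -; revert j; decide))
      (hadj (j + 1) (j + 2) (by clear * -; revert j; decide)) ((hp _ _).2 rfl).symm h.symm
  -- The arcs between `c j` and `c (j + 2)` have lengths 2 and 5 and give holes of lengths `n + 4`
  -- and `n + 7`. The odd one must be shorter than 9, so `n` is 1 or 3, and 1 is excluded by `hn2`.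
  have hlen2 : ∀ j (f : ℕ → V) (n : ℕ), f 0 = p j → f n = p (j + 2) → G.IsIndPath f n →
      (∀ i, 0 < i → i < n → ∃ k ≤ m, f i ∈ G.distLayer u k) → n = 3 := by
    intro j f n h0 hn hf hint
    have hn1 := hpath _ _ (by clear * -; revert j; decide) f n h0 hn
    have hint' : ∀ i, 0 < i → i < n → ∀ k, ¬ G.Adj (f i) (c k) := by
      intro i hi hin
      obtain ⟨k, hk, hfk⟩ := hint i hi hin
      exact hlow _ _ hk hfk
    have hne1 : n ≠ 1 := by
      rintro rfl
      have := (hf 0 1 (by omega) le_rfl).2 rfl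
      rw [h0, hn] at this
      exact hn2 _ this
    by_contra h3
    rcases Nat.even_or_odd n with he | ho
    · refine hG _ ?_ ?_ (hasHole_of_arc hc hp (m := 5) le_rfl
        (by clear * -; revert j; decide) hf h0 hn hn1 (by omega) hint')
      · obtain ⟨r, rfl⟩ := he; omega
      · rw [Nat.odd_iff]; rw [Nat.even_iff] at he; omega
    · have hrev : G.HasHole (n + 2 + 2) := by
        refine hasHole_of_arc (c := fun i => c (-i)) (p := fun i => p (-i)) (a := -j)
          (b := -(j + 2)) ?_ ?_ (by norm_num) ?_ hf ?_ ?_ hn1 (by omega) ?_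
        · intro i j
          rw [hc]
          revert i j; decide
        · intro i j
          rw [hp, neg_inj]
        · clear * -; revert j; decide
        · simpa using h0
        · simpa using hn
        · intro i hi hin k; exact hint' i hi hin _
      refine hG _ ?_ ?_ hrev
      · obtain ⟨r, rfl⟩ := ho; omega
      · rw [Nat.odd_iff] at *; omega
  -- Here the arcs have lengths 3 and 4, the holes `n + 5` and `n + 6`, which leaves only `n = 2`
  -- once `n = 1` is ruled out by non-adjacency.
  have hlen3 : ∀ j (f : ℕ → V) (n : ℕ), ¬ G.Adj (p j) (p (j + 3)) → f 0 = p j →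
      f n = p (j + 3) → G.IsIndPath f n →
      (∀ i, 0 < i → i < n → ∃ k ≤ m, f i ∈ G.distLayer u k) → n = 2 := by
    intro j f n hn3 h0 hn hf hint
    have hn1 := hpath _ _ (by clear * -; revert j; decide) f n h0 hn
    have hint' : ∀ i, 0 < i → i < n → ∀ k, ¬ G.Adj (f i) (c k) := by
      intro i hi hin
      obtain ⟨k, hk, hfk⟩ := hint i hi hin
      exact hlow _ _ hk hfk
    have hne1 : n ≠ 1 := by
      rintro rfl
      have := (hf 0 1 (by omega) le_rfl).2 rfl
      rw [h0, hn] at this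
      exact hn3 this
    by_contra h3
    rcases Nat.even_or_odd n with he | ho
    · have hrev : G.HasHole (n + 3 + 2) := by
        refine hasHole_of_arc (c := fun i => c (-i)) (p := fun i => p (-i)) (a := -j)
          (b := -(j + 3)) ?_ ?_ (by norm_num) ?_ hf ?_ ?_ hn1 (by omega) ?_
        · intro i j
          rw [hc]
          revert i j; decide
        · intro i j
          rw [hp, neg_inj]
        · clear * -; revert j; decide
        · simpa using h0
        · simpa using hn
        · intro i hi hin k; exact hint' i hi hin _
      refine hG _ ?_ ?_ hrev
      · obtain ⟨r, rfl⟩ := he; omega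
      · rw [Nat.odd_iff]; rw [Nat.even_iff] at he; omega
    · refine hG _ ?_ ?_ (hasHole_of_arc hc hp (m := 4) (by norm_num)
        (by clear * -; revert j; decide) hf h0 hn hn1 (by omega) hint')
      · obtain ⟨r, rfl⟩ := ho; omega
      · rw [Nat.odd_iff] at *; omega
  choose g hgL hgp using fun j => exists_parent (hpL j)
  -- The only candidates for the two interior vertices of a path of length 3 are `x` and `y`, since
  -- a neighbour of some `p j` cannot lie in a layer before `m`.
  have hcomplete : ∀ j x y, x ∈ G.distLayer u m → y ∈ G.distLayer u m → G.Adj x (p j) →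
      G.Adj y (p (j + 2)) → G.Adj x y := by
    intro j x y hx hy hxp hyp
    obtain ⟨f, n, h0, hn, hf, hint⟩ := exists_isIndPath_through hx hy hxp.symm hyp.symm
    obtain rfl := hlen2 j f n h0 hn hf (by
      intro i hi hin
      rcases hint i hi hin with ⟨k, hk, h⟩ | h | h
      · exact ⟨k, hk.le, h⟩
      · exact ⟨m, le_rfl, h ▸ hx⟩
      · exact ⟨m, le_rfl, h ▸ hy⟩)
    have a01 := (hf 0 1 (by omega) (by omega)).2 rfl
    have a12 := (hf 1 2 (by omega) (by omega)).2 rfl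
    have a23 := (hf 2 3 (by omega) (by omega)).2 rfl
    rw [h0] at a01
    rw [hn] at a23
    have h1 : f 1 = x ∨ f 1 = y := by
      rcases hint 1 (by omega) (by omega) with ⟨k, hk, h⟩ | h
      · exact absurd (distLayer_unique h (hlow' _ _ hk.le h _ a01.symm)) hk.ne
      · exact h
    have h2 : f 2 = x ∨ f 2 = y := by
      rcases hint 2 (by omega) (by omega) with ⟨k, hk, h⟩ | h
      · exact absurd (distLayer_unique h (hlow' _ _ hk.le h _ a23)) hk.ne
      · exact h
    rcases h1 with h1 | h1 <;> rcases h2 with h2 | h2 <;> rw [h1, h2] at a12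
    · exact absurd rfl a12.ne
    · exact a12
    · exact a12.symm
    · exact absurd rfl a12.ne
  -- Two grandparents above `p j` would both be adjacent to `g (j + 2)`, giving a square.
  have hunique : ∀ j x, x ∈ G.distLayer u m → G.Adj x (p j) → x = g j := by
    intro j x hx hxp
    have h1 := hcomplete j x _ hx (hgL (j + 2)) hxp (hgp _)
    have h2 := hcomplete j _ _ (hgL j) (hgL (j + 2)) (hgp j) (hgp _)
    refine hs.eq (a := p j) (c := g (j + 2)) ?_ hxp.symm h1.symm (hgp j).symm h2.symm
    intro he
    have := hpL j
    rw [he] at this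
    have := distLayer_unique this (hgL (j + 2))
    omega
  have hcommon : ∀ j, ¬ G.Adj (p j) (p (j + 3)) → g j = g (j + 3) := by
    intro j hn3
    obtain ⟨f, n, h0, hn, hf, hint⟩ := exists_isIndPath_above (hpL j) (hpL (j + 3))
    obtain rfl := hlen3 j f n hn3 h0 hn hf hint
    have a01 := (hf 0 1 (by omega) (by omega)).2 rfl
    have a12 := (hf 1 2 (by omega) (by omega)).2 rfl
    rw [h0] at a01
    rw [hn] at a12
    obtain ⟨k, hk, hfk⟩ := hint 1 (by omega) (by omega)
    have hf1 := hlow' _ _ hk hfk _ a12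
    rw [← hunique _ _ hf1 a01.symm, ← hunique _ _ hf1 a12]
  -- If both pairs are adjacent, `p j`, `p (j + 3)`, `p (j + 6)`, `c (j + 6)`, `c j` is a pentagon.
  -- If neither is, the three parents share one grandparent `g`, and `g`, `p (j + 6)`, `c (j + 6)`,
  -- `c j`, `p j` is a pentagon.
  have hflip : ∀ j, G.Adj (p (j + 3)) (p (j + 6)) ↔ ¬ G.Adj (p j) (p (j + 3)) := by
    intro j
    have hcc := hadj (j + 6) j (by clear * -; revert j; decide)
    have e1 := (hp j j).2 rfl
    have e2 := (hp (j + 6) (j + 6)).2 rfl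
    have hj : j + 3 + 3 = j + 6 := by clear * -; revert j; decide
    constructor
    · intro h1 h2
      exact h5 _ _ _ _ _ h2 h1 e2 hcc e1.symm
    · intro h1
      by_contra h2
      have k1 := hcommon j h1
      have k2 := hcommon (j + 3) (by rwa [hj])
      rw [hj] at k2
      have k3 := hgp j
      rw [k1.trans k2] at k3
      exact h5 _ _ _ _ _ (hgp (j + 6)) e2 hcc e1.symm k3.symm
  have f0 := hflip 0
  have f1 := hflip 1
  have f2 := hflip 2
  have f3 := hflip 3
  have f4 := hflip 4
  have f5 := hflip 5
  have f6 := hflip 6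
  simp only [Fin.reduceAdd] at f0 f1 f2 f3 f4 f5 f6
  -- Seven flips around an odd cycle make a proposition equivalent to its negation.
  tauto

lemma isBipartite_induce_distLayer (hg : 5 ≤ G.egirth) (h5 : G.NoPentagon)
    (hG : G.NoOddHoleFrom 9) (u : V) (i : ℕ) : (G.induce (G.distLayer u i)).IsBipartite := by
  have ht := noTriangle_of_egirth hg
  have hs := noSquare_of_egirth hg
  by_contra h
  obtain ⟨k, hk, hodd, -, ⟨e⟩⟩ := exists_odd_hole (G := G.induce (G.distLayer u i))
    (fun a b c h1 h2 h3 => ht a b c h1 h2 h3) h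
  have h9 : k < 9 := by
    by_contra h9
    exact hG k (by omega) hodd ⟨by omega, ⟨(Embedding.induce _).comp e⟩⟩
  have hadj : ∀ x y, G.Adj (e x).1 (e y).1 ↔ (cycleGraph k).Adj x y := fun x y => e.map_rel_iff
  have h57 : k = 5 ∨ k = 7 := by
    rw [Nat.odd_iff] at hodd; omega
  rcases h57 with rfl | rfl
  · exact h5 _ _ _ _ _ ((hadj 0 1).2 (by decide)) ((hadj 1 2).2 (by decide))
      ((hadj 2 3).2 (by decide)) ((hadj 3 4).2 (by decide)) ((hadj 4 0).2 (by decide))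
  · exact not_seven_hole_in_distLayer ht hs h5 hG (c := fun j => (e j).1)
      (fun x y => by rw [hadj]; exact cycleGraph_adj) u i (fun j => (e j).2)

/-- A coincidence or a chord in a closed walk of length five would create a triangle. -/
lemma hasHole_five_iff (ht : G.NoTriangle) : G.HasHole 5 ↔ ¬ G.NoPentagon := by
  constructor
  · rintro ⟨-, ⟨e⟩⟩ h5
    exact h5 _ _ _ _ _ (e.map_rel_iff.2 (show (cycleGraph 5).Adj 0 1 by decide))
      (e.map_rel_iff.2 (show (cycleGraph 5).Adj 1 2 by decide))
      (e.map_rel_iff.2 (show (cycleGraph 5).Adj 2 3 by decide))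
      (e.map_rel_iff.2 (show (cycleGraph 5).Adj 3 4 by decide))
      (e.map_rel_iff.2 (show (cycleGraph 5).Adj 4 0 by decide))
  · intro h
    simp only [NoPentagon] at h
    push Not at h
    obtain ⟨a, b, c, d, e, h1, h2, h3, h4, h5⟩ := h
    refine hasHole_of_forall_adj_iff le_rfl (fun t => ![a, b, c, d, e] (Fin.ofNat 5 t)) ?_
    have n1 := ht _ _ _ h1 h2
    have n2 := ht _ _ _ h2 h3
    have n3 := ht _ _ _ h3 h4
    have n4 := ht _ _ _ h4 h5
    have n5 := ht _ _ _ h5 h1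
    intro i j hij hj
    interval_cases j <;> interval_cases i <;> simp [Fin.ofNat, *] <;>
      simp_all [G.adj_comm]

/-! ### Greedy colouring by rank -/

/-- The neighbours of `x` in `X` of smaller rank. -/
def lowerNeighbors (G : SimpleGraph V) (rk : V → ℕ) (X : Set V) (x : V) : Set V :=
  {z | z ∈ X ∧ G.Adj x z ∧ rk z < rk x}

/-- The vertices of `X` with at least `d` neighbours in `X` of smaller rank. -/
def heavyPart (G : SimpleGraph V) (rk : V → ℕ) (d : ℕ) (X : Set V) : Set V :=
  {x | x ∈ X ∧ d ≤ (G.lowerNeighbors rk X x).ncard}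

/-- Greedy colouring in order of increasing rank. Vertices of equal rank are non-adjacent, so a
whole rank class is coloured at once. -/
lemma colorable_of_ncard_lowerNeighbors_lt [Finite V] {rk : V → ℕ} {W : Set V} {d : ℕ}
    (hrk : ∀ x ∈ W, ∀ y ∈ W, G.Adj x y → rk x ≠ rk y)
    (hd : ∀ x ∈ W, (G.lowerNeighbors rk W x).ncard < d) : (G.induce W).Colorable d := by
  classical
  have key : ∀ n, ∃ col : V → ℕ, (∀ x ∈ W, rk x < n → col x < d) ∧
      ∀ x ∈ W, ∀ y ∈ W, rk x < n → rk y < n → G.Adj x y → col x ≠ col y := by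
    intro n
    induction n with
    | zero => exact ⟨fun _ => 0, by simp, by simp⟩
    | succ n ih =>
      obtain ⟨col, h1, h2⟩ := ih
      have hfree : ∀ x, ∃ k, x ∈ W → k < d ∧ ∀ z ∈ G.lowerNeighbors rk W x, col z ≠ k := by
        intro x
        by_cases hx : x ∈ W
        · let N := (Set.toFinite (G.lowerNeighbors rk W x)).toFinset
          have hN : (N.image col).card < (Finset.range d).card := by
            rw [Finset.card_range]
            refine Finset.card_image_le.trans_lt ?_
            rw [← Set.ncard_eq_toFinset_card]
            exact hd x hx
          obtain ⟨k, hk, hk'⟩ := Finset.exists_mem_notMem_of_card_lt_card hN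
          refine ⟨k, fun _ => ⟨Finset.mem_range.1 hk, fun z hz he => hk' ?_⟩⟩
          exact Finset.mem_image.2 ⟨z, by simpa [N] using hz, he⟩
        · exact ⟨0, fun h => absurd h hx⟩
      choose fr hfr using hfree
      refine ⟨fun x => if rk x = n then fr x else col x, ?_, ?_⟩
      · intro x hx hxn
        by_cases hr : rk x = n
        · simpa only [hr, if_true] using (hfr x hx).1
        · simpa only [hr, if_false] using h1 x hx (by omega)
      · intro x hx y hy hxn hyn hxy
        by_cases hr : rk x = n <;> by_cases hs : rk y = n <;> simp only [hr, hs, if_true, if_false]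
        · exact absurd (hr.trans hs.symm) (hrk x hx y hy hxy)
        · exact ((hfr x hx).2 y ⟨hy, hxy, by omega⟩).symm
        · exact (hfr y hy).2 x ⟨hx, hxy.symm, by omega⟩
        · exact h2 x hx y hy (by omega) (by omega) hxy
  obtain ⟨n, hn⟩ := (Set.finite_range rk).bddAbove
  obtain ⟨col, h1, h2⟩ := key (n + 1)
  have hlt : ∀ x, rk x < n + 1 := fun x => Nat.lt_succ_of_le (hn ⟨x, rfl⟩)
  exact colorable_induce_iff.2 ⟨col, fun x hx => h1 x hx (hlt x),
    fun x hx y hy => h2 x hx y hy (hlt x) (hlt y)⟩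

lemma colorable_of_heavyPart [Finite V] {rk : V → ℕ} {X : Set V} {d m : ℕ}
    (hrk : ∀ x ∈ X, ∀ y ∈ X, G.Adj x y → rk x ≠ rk y)
    (h : (G.induce (G.heavyPart rk d X)).Colorable m) : (G.induce X).Colorable (m + d) := by
  refine colorable_induce_of_sdiff h (colorable_of_ncard_lowerNeighbors_lt
    (fun x hx y hy => hrk x hx.1 y hy.1) fun x hx => ?_)
  refine lt_of_le_of_lt (Set.ncard_le_ncard (t := G.lowerNeighbors rk X x)
    (fun z hz => ⟨hz.1.1, hz.2⟩) (Set.toFinite _)) ?_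
  by_contra h
  exact hx.2 ⟨hx.1, not_lt.1 h⟩

/-- By `NoSquare`, each `r ∈ F` has at most one common neighbour with `x`, so `F` spoils fewer than
`d` lower neighbours. -/
lemma exists_lowerNeighbor_avoiding [Finite V] (hs : G.NoSquare) {rk : V → ℕ} {X : Set V} {d : ℕ}
    {x : V} (hx : x ∈ G.heavyPart rk d X) (F : Finset V) (hF : F.card < d) (hxF : x ∉ F) :
    ∃ z ∈ X, G.Adj x z ∧ rk z < rk x ∧ ∀ r ∈ F, ¬ G.Adj r z := by
  by_contra! h
  have h' : ∀ z, ∃ r, z ∈ G.lowerNeighbors rk X x → r ∈ F ∧ G.Adj r z := by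
    intro z
    by_cases hz : z ∈ G.lowerNeighbors rk X x
    · obtain ⟨r, hr⟩ := h z hz.1 hz.2.1 hz.2.2
      exact ⟨r, fun _ => hr⟩
    · exact ⟨z, fun h => absurd h hz⟩
  choose r hr using h'
  have := Set.ncard_le_ncard_of_injOn (s := G.lowerNeighbors rk X x) (t := (F : Set V)) r
    (fun z hz => (hr z hz).1) (by
      intro z hz z' hz' he
      have h1 := hr z hz
      have h2 := (hr z' hz').2
      rw [← he] at h2
      exact hs.eq (by rintro rfl; exact hxF h1.1) hz.2.1 h1.2 hz'.2.1 h2) (Set.toFinite _)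
  rw [Set.ncard_coe_finset] at this
  have := hx.2
  omega

/-! ### Layers that may contain pentagons -/

/-- A pentagon in a layer, together with a pendant path of length three whose end has a parent
adjacent to nothing else, extends to a long odd hole. -/
lemma exists_long_odd_hole {u : V} {m n : ℕ} {c : Fin 5 → V} {x₁ x₂ x₃ p q : V} {f : ℕ → V}
    (hc : ∀ i j, G.Adj (c i) (c j) ↔ i - j = 1 ∨ j - i = 1)
    (hcL : ∀ j, c j ∈ G.distLayer u (m + 2)) (hx₁ : x₁ ∈ G.distLayer u (m + 2))
    (hx₂ : x₂ ∈ G.distLayer u (m + 2)) (hx₃ : x₃ ∈ G.distLayer u (m + 2))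
    (hcx₁ : ∀ j, G.Adj (c j) x₁ ↔ j = 0) (hcx₂ : ∀ j, ¬ G.Adj (c j) x₂)
    (hcx₃ : ∀ j, ¬ G.Adj (c j) x₃) (h₁₂ : G.Adj x₁ x₂) (h₂₃ : G.Adj x₂ x₃) (h₁₃ : ¬ G.Adj x₁ x₃)
    (hqc : ∀ j, G.Adj q (c j) ↔ j = 2) (hq₁ : ¬ G.Adj q x₁) (hq₂ : ¬ G.Adj q x₂)
    (hq₃ : ¬ G.Adj q x₃) (hpc : ∀ j, ¬ G.Adj p (c j)) (hp₁ : ¬ G.Adj p x₁) (hp₂ : ¬ G.Adj p x₂)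
    (hp₃ : G.Adj p x₃) (h0 : f 0 = p) (hn : f n = q) (hf : G.IsIndPath f n)
    (hint : ∀ i, 0 < i → i < n → ∃ k ≤ m, f i ∈ G.distLayer u k) :
    ∃ k, 9 ≤ k ∧ Odd k ∧ G.HasHole k := by
  have hpq : p ≠ q := by
    rintro rfl
    exact hq₃ hp₃
  have hn1 : 1 ≤ n := by
    rcases Nat.eq_zero_or_pos n with rfl | h
    · exact absurd (h0.symm.trans hn) hpq
    · exact h
  have close : ∀ (g : ℕ → V) (M : ℕ), 2 ≤ M → G.IsIndPath g M →
      (∀ j ≤ M, g j ∈ G.distLayer u (m + 2)) → (∀ j ≤ M, G.Adj q (g j) ↔ j = 0) →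
      (∀ j ≤ M, G.Adj p (g j) ↔ j = M) → G.HasHole (n + M + 2) := by
    intro g M hM hg hgL hgq hgp
    refine hasHole_of_isIndPath (by omega) hf hg ?_
    intro i j hi hj
    rcases Nat.eq_zero_or_pos i with rfl | hi0
    · rw [h0, hgp j hj]; omega
    · rcases hi.lt_or_eq with hin | rfl
      · obtain ⟨k, hk, hfk⟩ := hint i hi0 hin
        have : ¬ G.Adj (f i) (g j) := by
          intro h
          have := distLayer_adj_le hfk (hgL j hj) h
          omega
        simp only [this, false_iff]
        omega
      · rw [hn, hgq j hj]; omega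
  -- The two ways round the pentagon from `c 2` to `c 0` have lengths 2 and 3, so the route to `x₃`
  -- has length 5 or 6. The one making the hole odd is chosen; `n ≥ 1` then gives length at least 9.
  rcases Nat.even_or_odd n with he | ho
  · refine ⟨n + 5 + 2, ?_, ?_, close
      (fun t => ![c 2, c 1, c 0, x₁, x₂, x₃] (Fin.ofNat 6 t)) 5 (by norm_num) ?_ ?_ ?_ ?_⟩
    · rw [Nat.even_iff] at he; omega
    · rw [Nat.odd_iff]; rw [Nat.even_iff] at he; omega
    · intro i j hij hj
      interval_cases j <;> interval_cases i <;> (simp [Fin.ofNat, *]; try decide)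
    · intro j hj
      interval_cases j <;> simp [Fin.ofNat, *]
    · intro j hj
      interval_cases j <;> simp [Fin.ofNat, *]
    · intro j hj
      interval_cases j <;> simp [Fin.ofNat, *]
  · refine ⟨n + 6 + 2, ?_, ?_, close
      (fun t => ![c 2, c 3, c 4, c 0, x₁, x₂, x₃] (Fin.ofNat 7 t)) 6 (by norm_num) ?_ ?_ ?_ ?_⟩
    · omega
    · rw [Nat.odd_iff] at *; omega
    · intro i j hij hj
      interval_cases j <;> interval_cases i <;> simp [Fin.ofNat, *] <;> decide
    · intro j hj
      interval_cases j <;> simp [Fin.ofNat, *]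
    · intro j hj
      interval_cases j <;> simp [Fin.ofNat, *]
    · intro j hj
      interval_cases j <;> simp [Fin.ofNat, *]

lemma colorable_four (hg : 5 ≤ G.egirth) (hG : G.NoOddHoleFrom 9) (h5 : G.NoPentagon) :
    G.Colorable 4 :=
  colorable_of_distLayer (m := 2) fun u i => isBipartite_induce_distLayer hg h5 hG u i

/-- A vertex set that is not `4`-colourable contains a pentagon. -/
lemma exists_pentagon_of_not_colorable (hg : 5 ≤ G.egirth) (hG : G.NoOddHoleFrom 9) {X : Set V}
    (hX : ¬ (G.induce X).Colorable 4) :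
    ∃ c : Fin 5 → V, (∀ j, c j ∈ X) ∧
      ∀ i j, G.Adj (c i) (c j) ↔ i - j = 1 ∨ j - i = 1 := by
  have hind : (G.induce X).IsIndContained G := ⟨Embedding.induce X⟩
  have hg' : 5 ≤ (G.induce X).egirth := hg.trans hind.isContained.egirth_le
  have h5 : ¬ (G.induce X).NoPentagon := fun h5 =>
    hX (colorable_four hg' (fun k hk ho hh => hG k hk ho ⟨hh.1, hh.2.trans hind⟩) h5)
  obtain ⟨-, ⟨e⟩⟩ := (hasHole_five_iff (noTriangle_of_egirth hg')).2 h5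
  refine ⟨fun j => (e j).1, fun j => (e j).2, fun i j => ?_⟩
  have : G.Adj (e i).1 (e j).1 ↔ (cycleGraph 5).Adj i j := e.map_rel_iff
  rw [this]
  exact cycleGraph_adj

/-- The bound is 4 + 8 + 8 + 8: one round of 8 for each vertex of the descending path `x₁`, `x₂`,
`x₃`, and 4 for the remaining set if it has no pentagon. -/
lemma colorable_induce_distLayer [Finite V] (hg : 5 ≤ G.egirth) (hG : G.NoOddHoleFrom 9) (u : V)
    (i : ℕ) : (G.induce (G.distLayer u i)).Colorable 28 := by
  classical
  have ht := noTriangle_of_egirth hg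
  have hs := noSquare_of_egirth hg
  obtain _ | m := i
  · refine colorable_induce_iff.2 ⟨fun _ => 0, by simp, fun x hx y hy hxy => ?_⟩
    rw [distLayer_zero hx, distLayer_zero hy] at hxy
    exact absurd rfl hxy.ne
  set L := G.distLayer u (m + 1) with hL
  obtain ⟨ρ, hρ⟩ : ∃ ρ : V → ℕ, Function.Injective ρ :=
    ⟨fun x => Finite.equivFin V x, Fin.val_injective.comp (Finite.equivFin V).injective⟩
  -- Choosing the `ρ`-least parent ensures that `p x` is adjacent to no vertex of the layer of
  -- larger rank than `x`.
  have hpar : ∀ x, ∃ y, x ∈ L → y ∈ G.distLayer u m ∧ G.Adj y x ∧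
      ∀ z ∈ G.distLayer u m, G.Adj z x → ρ y ≤ ρ z := by
    intro x
    by_cases hx : x ∈ L
    · obtain ⟨y, hy, hyx⟩ := exists_parent hx
      obtain ⟨z, hz, hmin⟩ := Set.exists_min_image {z | z ∈ G.distLayer u m ∧ G.Adj z x} ρ
        (Set.toFinite _) ⟨y, hy, hyx⟩
      exact ⟨z, fun _ => ⟨hz.1, hz.2, fun w hw hwx => hmin w ⟨hw, hwx⟩⟩⟩
    · exact ⟨x, fun h => absurd h hx⟩
  choose p hp using hpar
  let rk : V → ℕ := fun x => ρ (p x)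
  have hlt : ∀ x ∈ L, ∀ y ∈ L, rk x < rk y → ¬ G.Adj (p x) y := by
    intro x hx y hy hxy h
    exact absurd ((hp y hy).2.2 _ (hp x hx).1 h) (not_le.2 hxy)
  -- Equal ranks mean a common parent, which with an edge would form a triangle.
  have hrk : ∀ x ∈ L, ∀ y ∈ L, G.Adj x y → rk x ≠ rk y := by
    intro x hx y hy hxy he
    have h1 := (hp y hy).2.1
    rw [← hρ he] at h1
    exact ht _ _ _ (hp x hx).2.1 hxy h1.symm
  set X₁ := G.heavyPart rk 8 L with hX₁
  set X₂ := G.heavyPart rk 8 X₁ with hX₂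
  have h₁L : ∀ x ∈ X₁, x ∈ L := fun x hx => hx.1
  have h₂L : ∀ x ∈ X₂, x ∈ L := fun x hx => h₁L x hx.1
  refine colorable_of_heavyPart (m := 20) (d := 8) hrk ?_
  refine colorable_of_heavyPart (m := 12) (d := 8)
    (fun x hx y hy => hrk x (h₁L x hx) y (h₁L y hy)) ?_
  refine colorable_of_heavyPart (m := 4) (d := 8)
    (fun x hx y hy => hrk x (h₂L x hx) y (h₂L y hy)) ?_
  by_contra hX
  obtain ⟨c₀, hc₀X, hc₀⟩ := exists_pentagon_of_not_colorable hg hG hX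
  -- The pentagon is rotated so that `c 0` has least rank. The path descending from `c 0` then stays
  -- off the pentagon, and the parent of its end sees no pentagon vertex.
  obtain ⟨c, hcX, hc, hcmin⟩ : ∃ c : Fin 5 → V, (∀ j, c j ∈ G.heavyPart rk 8 X₂) ∧
      (∀ i j, G.Adj (c i) (c j) ↔ i - j = 1 ∨ j - i = 1) ∧ ∀ j, rk (c 0) ≤ rk (c j) := by
    obtain ⟨j₀, hj₀⟩ := Finite.exists_min (fun j => rk (c₀ j))
    refine ⟨fun j => c₀ (j + j₀), fun j => hc₀X _, fun i j => ?_, fun j => ?_⟩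
    · rw [hc₀, add_sub_add_right_eq_sub, add_sub_add_right_eq_sub]
    · simpa using hj₀ (j + j₀)
  have hcL : ∀ j, c j ∈ L := fun j => h₂L _ (hcX j).1
  have hadj : ∀ i j, (i - j = 1 ∨ j - i = 1) → G.Adj (c i) (c j) := fun i j => (hc i j).2
  have hcinj : ∀ i j, i ≠ j → c i ≠ c j := by
    intro i j hij he
    obtain ⟨k, h1, h2⟩ : ∃ k, (i - k = 1 ∨ k - i = 1) ∧ ¬ (j - k = 1 ∨ k - j = 1) := by
      clear * - hij; revert i j; decide
    rw [← hc, he, hc] at h1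
    exact h2 h1
  have hmL : ∀ x ∈ L, ∀ y ∈ G.distLayer u m, x ≠ y := by
    rintro x hx _ hy rfl
    have := distLayer_unique hx hy
    omega
  set q := p (c 2) with hq
  have hqm : q ∈ G.distLayer u m := (hp _ (hcL 2)).1
  have hq2 : G.Adj q (c 2) := (hp _ (hcL 2)).2.1
  have hqc : ∀ j, G.Adj q (c j) ↔ j = 2 := by
    intro j
    refine ⟨fun h => ?_, by rintro rfl; exact hq2⟩
    have hj : j = 0 ∨ j = 1 ∨ j = 2 ∨ j = 3 ∨ j = 4 := by clear * -; revert j; decide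
    rcases hj with rfl | rfl | rfl | rfl | rfl
    · rcases hs _ _ _ _ hq2 (hadj 2 1 (by decide)) (hadj 1 0 (by decide)) h.symm with h' | h'
      · exact absurd h'.symm (hmL _ (hcL 1) _ hqm)
      · exact absurd h' (hcinj _ _ (by decide))
    · exact absurd h.symm (ht _ _ _ hq2 (hadj 2 1 (by decide)))
    · rfl
    · exact absurd h.symm (ht _ _ _ hq2 (hadj 2 3 (by decide)))
    · rcases hs _ _ _ _ hq2 (hadj 2 3 (by decide)) (hadj 3 4 (by decide)) h.symm with h' | h'
      · exact absurd h'.symm (hmL _ (hcL 3) _ hqm)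
      · exact absurd h' (hcinj _ _ (by decide))
  have hcx : ∀ x, rk x < rk (c 0) → ∀ j, x ≠ c j := by
    rintro x hx j rfl
    exact absurd (hcmin j) (not_le.2 hx)
  obtain ⟨x₁, hx₁X, h01, hr₁, hav₁⟩ := exists_lowerNeighbor_avoiding hs (hcX 0)
    (insert q ((Finset.univ.erase 0).image c))
    (lt_of_le_of_lt (Finset.card_insert_le _ _)
      (lt_of_le_of_lt (Nat.add_le_add_right Finset.card_image_le 1) (by decide)))
    (by
      simp only [Finset.mem_insert, Finset.mem_image, Finset.mem_erase, Finset.mem_univ, and_true,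
        not_or, not_exists, not_and]
      exact ⟨hmL _ (hcL 0) _ hqm, fun j hj => hcinj _ _ hj⟩)
  have hx₁L := h₂L _ hx₁X
  obtain ⟨x₂, hx₂X, h12, hr₂, hav₂⟩ := exists_lowerNeighbor_avoiding hs hx₁X
    (insert q (Finset.univ.image c))
    (lt_of_le_of_lt (Finset.card_insert_le _ _)
      (lt_of_le_of_lt (Nat.add_le_add_right Finset.card_image_le 1) (by decide)))
    (by
      simp only [Finset.mem_insert, Finset.mem_image, Finset.mem_univ, true_and,
        not_or, not_exists]
      exact ⟨hmL _ hx₁L _ hqm, fun j => (hcx _ hr₁ j).symm⟩)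
  have hx₂L := h₁L _ hx₂X
  -- The largest set to avoid: `x₁`, `q` and five pentagon vertices. These 7 account for the
  -- constant 8.
  obtain ⟨x₃, hx₃L, h23, hr₃, hav₃⟩ := exists_lowerNeighbor_avoiding hs hx₂X
    (insert x₁ (insert q (Finset.univ.image c)))
    (lt_of_le_of_lt ((Finset.card_insert_le _ _).trans
        (Nat.add_le_add_right (Finset.card_insert_le _ _) 1))
      (lt_of_le_of_lt (Nat.add_le_add_right (Nat.add_le_add_right Finset.card_image_le 1) 1)
        (by decide)))
    (by
      simp only [Finset.mem_insert, Finset.mem_image, Finset.mem_univ, true_and,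
        not_or, not_exists]
      exact ⟨h12.ne.symm, hmL _ hx₂L _ hqm, fun j => (hcx _ (hr₂.trans hr₁) j).symm⟩)
  simp only [Finset.mem_insert, Finset.mem_image, Finset.mem_erase, Finset.mem_univ, and_true,
    true_and, forall_eq_or_imp, forall_exists_index, and_imp, forall_apply_eq_imp_iff₂,
    forall_apply_eq_imp_iff] at hav₁ hav₂ hav₃
  have hx₃ := hp x₃ hx₃L
  -- In the first layer the root is the only parent, so `q` would be adjacent to `x₃`.
  obtain _ | m := m
  · have h1 := distLayer_zero hx₃.1
    rw [← distLayer_zero hqm] at h1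
    exact hav₃.2.1 (h1 ▸ hx₃.2.1)
  obtain ⟨f, n, h0, hn, hf, hint⟩ := exists_isIndPath_above hx₃.1 hqm
  obtain ⟨k, hk, ho, hh⟩ := exists_long_odd_hole hc hcL hx₁L hx₂L hx₃L
    (fun j => ⟨fun h => by_contra fun hj => hav₁.2 j hj h, by rintro rfl; exact h01⟩)
    hav₂.2 hav₃.2.2 h12 h23 hav₃.1 hqc hav₁.1 hav₂.1 hav₃.2.1
    (fun j => hlt _ hx₃L _ (hcL j) ((hr₃.trans (hr₂.trans hr₁)).trans_le (hcmin j)))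
    (hlt _ hx₃L _ hx₁L (hr₃.trans hr₂)) (hlt _ hx₃L _ hx₂L hr₃) hx₃.2.1 h0 hn hf hint
  exact hG k hk ho hh

lemma six_le_egirth_of_noPentagon (hg : 5 ≤ G.egirth) (h5 : G.NoPentagon) : 6 ≤ G.egirth := by
  rw [le_egirth]
  intro a w hw
  have h1 : 5 ≤ w.length := by exact_mod_cast hg.trans (egirth_le_length hw)
  have h2 : w.length ≠ 5 := by
    intro h
    have hstep : ∀ i, i < 5 → G.Adj (w.getVert i) (w.getVert (i + 1)) :=
      fun i hi => w.adj_getVert_succ (by omega)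
    have h4 := hstep 4 (by norm_num)
    have he : w.getVert 5 = w.getVert 0 := by rw [← h]; simp
    rw [he] at h4
    exact h5 _ _ _ _ _ (hstep 0 (by norm_num)) (hstep 1 (by norm_num)) (hstep 2 (by norm_num))
      (hstep 3 (by norm_num)) h4
  exact_mod_cast (by omega : 6 ≤ w.length)

end SimpleGraph

theorem theorem1 {V : Type*} [Finite V] (G : SimpleGraph V) :
    (G.InClassG 2 → G.Colorable 1456) ∧
    (G.InClassA 3 ↔ G.InClassG 2 ∧ ¬ G.HasHole 5) ∧
    (G.InClassG 2 → ¬ G.HasHole 5 →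
      G.Colorable 4 ∧
      ∀ (u : V) (i : ℕ), (G.induce (G.distLayer u i)).IsBipartite) := by
  refine ⟨fun ⟨hg, hG⟩ => ?_, ⟨fun ⟨hg, hG⟩ => ?_, fun ⟨⟨hg, hG⟩, h5⟩ => ?_⟩,
    fun ⟨hg, hG⟩ h5 => ?_⟩
  · exact (SimpleGraph.colorable_of_distLayer
      (SimpleGraph.colorable_induce_distLayer hg hG)).mono (by norm_num)
  · have h5 : 5 ≤ G.egirth := le_trans (by norm_num) hg
    exact ⟨⟨h5, hG⟩, fun h => (SimpleGraph.hasHole_five_iff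
      (SimpleGraph.noTriangle_of_egirth h5)).1 h (SimpleGraph.noPentagon_of_egirth hg)⟩
  · rw [SimpleGraph.hasHole_five_iff (SimpleGraph.noTriangle_of_egirth hg), not_not] at h5
    exact ⟨SimpleGraph.six_le_egirth_of_noPentagon hg h5, hG⟩
  · rw [SimpleGraph.hasHole_five_iff (SimpleGraph.noTriangle_of_egirth hg), not_not] at h5
    exact ⟨SimpleGraph.colorable_four hg hG h5, SimpleGraph.isBipartite_induce_distLayer hg h5 hG⟩
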